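/- **Theorem (lopsided Fubini).** Let $(I,\mathcal A,\lambda)$ and $(J,\mathcal B,\pi)$ be probability spaces. Let $\varphi:\mathcal B\to\mathbb R$ be a setfunction that is * increasing: $\varphi(X)\le\varphi(Y)$ for $X\subseteq Y$ in $\mathcal B$; * submodular: $\varphi(S\cup T)+\varphi(S\cap T)\le\varphi(S)+\varphi(T)$ for all $S,T\in\mathcal B$; * absolutely continuous with respect to $\pi$: for every $\varepsilon>0$ there is a $\delta>0$ such that $|\varphi(S)|<\varepsilon$ for every $S\in\mathcal B$ with $\pi(S)<\delta$ (in particular, $\varphi(\emptyset)=0$). For a bounded $\mathcal B$-measurable function $f:J\to\mathbb R$, let $$\widehat\varphi(f)=\int_c^\infty \varphi\{x\in J: f(x)\ge t\}\,dt+c\,\varphi(J),\qquad c\le\inf f,$$ be the Choquet integral of $f$ (the value does not depend on the choice of $c\le\inf f$; to be definite, take $c=\inf f$). Let $F:J\times I\to\mathbb R$ be a bounded function, measurable with respect to the product sigma-algebra, and define $F_y(x)=F(x,y)$ and $g(x)=\int_I F(x,y)\,d\lambda(y)$. Then the function $y\mapsto\widehat\varphi(F_y)$ is $\lambda$-integrable,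 and $$\widehat\varphi(g)\le\int_I\widehat\varphi(F_y)\,d\lambda(y).$$ -/

import Mathlib

open MeasureTheory Set

/-- A setfunction on the sigma-algebra of `J` is represented by `φ : Set J → ℝ`; only its values on
measurable sets are ever constrained or used. It is increasing if `φ X ≤ φ Y` for measurable
`X ⊆ Y`. -/
def SetfunIncreasing {J : Type*} [MeasurableSpace J] (φ : Set J → ℝ) : Prop :=
  ∀ X Y : Set J, MeasurableSet X → MeasurableSet Y → X ⊆ Y → φ X ≤ φ Y

/-- Submodularity on the sigma-algebra of `J`. -/
def SetfunSubmodular {J : Type*} [MeasurableSpace J] (φ : Set J → ℝ) : Prop :=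
  ∀ S T : Set J, MeasurableSet S → MeasurableSet T → φ (S ∪ T) + φ (S ∩ T) ≤ φ S + φ T

/-- Absolute continuity (in the `ε`-`δ` sense) of a setfunction with respect to a measure. -/
def SetfunAbsCont {J : Type*} [MeasurableSpace J] (φ : Set J → ℝ) (π : Measure J) : Prop :=
  ∀ ε : ℝ, 0 < ε → ∃ δ : ℝ, 0 < δ ∧
    ∀ S : Set J, MeasurableSet S → π S < ENNReal.ofReal δ → |φ S| < ε

/-- The Choquet integral computed from the base level `c`:
`∫_c^∞ φ {f ≥ t} dt + c φ(J)`. -/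
noncomputable def choquetFrom {J : Type*} (φ : Set J → ℝ) (c : ℝ) (f : J → ℝ) : ℝ :=
  (∫ t in Ioi c, φ {x | t ≤ f x}) + c * φ univ

/-- The Choquet extension `φ̂(f)` of a setfunction to bounded measurable functions, computed from
the base level `c = inf f`; by `choquet_eq_choquetFrom` any `c ≤ inf f` gives the same value. -/
noncomputable def choquet {J : Type*} (φ : Set J → ℝ) (f : J → ℝ) : ℝ :=
  choquetFrom φ (⨅ x, f x) f

/-- For an increasing setfunction with `φ ∅ = 0` and a bounded measurable `f`, the integrand in the
Choquet integral is integrable. -/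
theorem integrableOn_setfun_level {J : Type*} [MeasurableSpace J] (φ : Set J → ℝ)
    (hφ : SetfunIncreasing φ) (h0 : φ ∅ = 0) (f : J → ℝ) (hf : Measurable f)
    (C : ℝ) (hC : ∀ x, |f x| ≤ C) (c : ℝ) :
    IntegrableOn (fun t => φ {x | t ≤ f x}) (Ioi c) := by
  have hm : ∀ t : ℝ, MeasurableSet {x | t ≤ f x} := fun t => measurableSet_le measurable_const hf
  have hanti : Antitone (fun t => φ {x | t ≤ f x}) := fun s t hst =>
    hφ _ _ (hm t) (hm s) (fun x (hx : t ≤ f x) => hst.trans hx)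
  have h1 : IntegrableOn (fun t => φ {x | t ≤ f x}) (Icc c (max c C)) :=
    (hanti.antitoneOn _).integrableOn_isCompact isCompact_Icc
  have h2 : IntegrableOn (fun t => φ {x | t ≤ f x}) (Ioi (max c C)) := by
    refine (integrableOn_congr_fun (g := fun _ => (0 : ℝ)) ?_ measurableSet_Ioi).2
      integrableOn_zero
    intro t ht
    have : {x | t ≤ f x} = ∅ := by
      ext x
      have := (abs_le.1 (hC x)).2
      have := (le_max_right c C).trans_lt ht
      simp only [mem_ofPred_eq, mem_empty_iff_false, iff_false, not_le]
      linarith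
    simp [this, h0]
  refine (h1.union h2).mono_set fun t ht => ?_
  rcases le_or_gt t (max c C) with h | h
  · exact Or.inl ⟨le_of_lt ht, h⟩
  · exact Or.inr h

/-- The Choquet integral does not depend on the base level. -/
theorem choquet_eq_choquetFrom {J : Type*} [MeasurableSpace J] (φ : Set J → ℝ)
    (hφ : SetfunIncreasing φ) (h0 : φ ∅ = 0) (f : J → ℝ) (hf : Measurable f)
    (C : ℝ) (hC : ∀ x, |f x| ≤ C) (c : ℝ) (hc : c ≤ ⨅ x, f x) :
    choquet φ f = choquetFrom φ c f := by
  set m := ⨅ x, f x with hm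
  have hbdd : BddBelow (range f) := ⟨-C, by rintro _ ⟨x, rfl⟩; exact (abs_le.1 (hC x)).1⟩
  have hint := integrableOn_setfun_level φ hφ h0 f hf C hC
  have hsplit : (∫ t in Ioi c, φ {x | t ≤ f x})
      = (∫ t in Ioc c m, φ {x | t ≤ f x}) + ∫ t in Ioi m, φ {x | t ≤ f x} := by
    rw [← Ioc_union_Ioi_eq_Ioi hc]
    exact setIntegral_union (Ioc_disjoint_Ioi le_rfl) measurableSet_Ioi
      ((hint c).mono_set Ioc_subset_Ioi_self) (hint m)
  have hconst : (∫ t in Ioc c m, φ {x | t ≤ f x}) = (m - c) * φ univ := by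
    rw [setIntegral_congr_fun (g := fun _ => φ univ) measurableSet_Ioc]
    · simp [hc]
    · intro t ht
      have : {x | t ≤ f x} = univ := eq_univ_of_forall fun x => ht.2.trans (ciInf_le hbdd x)
      simp [this]
  rw [choquet, choquetFrom, choquetFrom, ← hm, hsplit, hconst]
  ring

/-!
The Choquet integral of a submodular setfunction is a convex functional, and the theorem is Jensen's
inequality for it, applied to the random element `y ↦ F_y` of `L¹(π)`, whose mean is `g`.

Convexity is positive homogeneity (`choquet_const_mul`) together with subadditivity
(`choquet_add_le`). For the latter, submodularity applied level by level gives
`φ̂(f + h • 1_A) ≤ φ̂(f) + h φ(A)` (`choquet_add_indicator_le`); a general summand `g` is uniformly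
close to an equally spaced sum of indicators of its level sets, and the corresponding sum of values
of `φ` is a lower Riemann sum for `φ̂(g)`.

Jensen's inequality for a Bochner integral needs a functional that is continuous on a closed convex
set. Absolute continuity of `φ` makes `φ̂` invariant under almost everywhere equality
(`choquet_congr_ae`) and continuous in `L¹(π)` on functions with a common bound
(`continuous_choquetL1`). Moreover `y ↦ F_y` has to be strongly measurable into `L¹(π)`; this holds
because `F` is measurable for the product sigma-algebra (`stronglyMeasurable_toLp_section`), and it
also gives the measurability of `y ↦ φ̂(F_y)`. Finally, the Bochner mean of the `F_y` is the
pointwise mean `g` by Fubini's theorem (`coeFn_integral_toLp_section`).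
-/

/-! ### The Choquet integral of a submodular setfunction -/

section Choquet

variable {J : Type*} [MeasurableSpace J] {φ : Set J → ℝ}

theorem SetfunIncreasing.nonneg (hinc : SetfunIncreasing φ) (h0 : φ ∅ = 0) {S : Set J}
    (hS : MeasurableSet S) : 0 ≤ φ S :=
  h0 ▸ hinc ∅ S .empty hS (empty_subset S)

theorem SetfunAbsCont.map_empty {π : Measure J} (hac : SetfunAbsCont φ π) : φ ∅ = 0 := by
  by_contra h
  obtain ⟨δ, hδ, H⟩ := hac |φ ∅| (abs_pos.2 h)
  exact lt_irrefl _ (H ∅ .empty (by simpa using hδ))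

theorem SetfunAbsCont.of_measure_zero {π : Measure J} (hac : SetfunAbsCont φ π) {S : Set J}
    (hS : MeasurableSet S) (h : π S = 0) : φ S = 0 := by
  by_contra h'
  obtain ⟨δ, hδ, H⟩ := hac |φ S| (abs_pos.2 h')
  exact lt_irrefl _ (H S hS (by simpa [h] using hδ))

theorem SetfunIncreasing.antitone_level (hinc : SetfunIncreasing φ) {f : J → ℝ}
    (hf : Measurable f) {A : Set J} (hA : MeasurableSet A) :
    Antitone (fun t : ℝ => φ (A ∩ {x | t ≤ f x})) := fun _ _ hst =>
  hinc _ _ (hA.inter (measurableSet_le measurable_const hf))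
    (hA.inter (measurableSet_le measurable_const hf))
    (inter_subset_inter_right _ fun _ hx => hst.trans hx)

theorem SetfunIncreasing.antitone_level_univ (hinc : SetfunIncreasing φ) {f : J → ℝ}
    (hf : Measurable f) : Antitone (fun t : ℝ => φ {x | t ≤ f x}) := by
  simpa using hinc.antitone_level hf MeasurableSet.univ

/-- The Choquet integral of a bounded function is an interval integral over any interval
containing its range. -/
theorem choquet_eq_intervalIntegral [Nonempty J] (hinc : SetfunIncreasing φ) (h0 : φ ∅ = 0)
    {f : J → ℝ} (hf : Measurable f) {a b : ℝ} (ha : ∀ x, a ≤ f x) (hb : ∀ x, f x ≤ b) :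
    choquet φ f = (∫ t in a..b, φ {x | t ≤ f x}) + a * φ univ := by
  have hC : ∀ x, |f x| ≤ max |a| |b| := fun x => abs_le_max_abs_abs (ha x) (hb x)
  have hab : a ≤ b := (ha (Classical.arbitrary J)).trans (hb _)
  rw [choquet_eq_choquetFrom φ hinc h0 f hf _ hC a (le_ciInf ha), choquetFrom,
    intervalIntegral.integral_of_le hab]
  congr 1
  refine setIntegral_eq_of_subset_of_forall_sdiff_eq_zero measurableSet_Ioi
    Ioc_subset_Ioi_self fun t ht => ?_
  have htb : b < t := by
    by_contra h
    exact ht.2 ⟨ht.1, not_lt.1 h⟩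
  have : {x | t ≤ f x} = ∅ := eq_empty_of_forall_notMem fun x hx => by
    have := hb x
    have : t ≤ f x := hx
    linarith
  rw [this, h0]

theorem choquet_mono [Nonempty J] (hinc : SetfunIncreasing φ) (h0 : φ ∅ = 0)
    {f g : J → ℝ} (hf : Measurable f) (hg : Measurable g) {C D : ℝ} (hfC : ∀ x, |f x| ≤ C)
    (hgD : ∀ x, |g x| ≤ D) (hfg : ∀ x, f x ≤ g x) : choquet φ f ≤ choquet φ g := by
  have h1 : ∀ x, -(max C D) ≤ f x := fun x =>
    (neg_le_neg (le_max_left C D)).trans (abs_le.1 (hfC x)).1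
  have h2 : ∀ x, g x ≤ max C D := fun x => (abs_le.1 (hgD x)).2.trans (le_max_right C D)
  have x := Classical.arbitrary J
  rw [choquet_eq_intervalIntegral hinc h0 hf h1 (fun x => (hfg x).trans (h2 x)),
    choquet_eq_intervalIntegral hinc h0 hg (fun x => (h1 x).trans (hfg x)) h2]
  gcongr
  refine intervalIntegral.integral_mono_on ((h1 x).trans ((hfg x).trans (h2 x)))
    (hinc.antitone_level_univ hf).intervalIntegrable
    (hinc.antitone_level_univ hg).intervalIntegrable fun t _ => ?_
  exact hinc _ _ (measurableSet_le measurable_const hf) (measurableSet_le measurable_const hg)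
    fun y hy => le_trans hy (hfg y)

theorem choquet_add_const [Nonempty J] (hinc : SetfunIncreasing φ) (h0 : φ ∅ = 0)
    {f : J → ℝ} (hf : Measurable f) {C : ℝ} (hC : ∀ x, |f x| ≤ C) (c : ℝ) :
    choquet φ (fun x => f x + c) = choquet φ f + c * φ univ := by
  rw [choquet_eq_intervalIntegral hinc h0 (hf.add_const c) (a := -C + c) (b := C + c)
      (fun x => by have := abs_le.1 (hC x); linarith)
      (fun x => by have := abs_le.1 (hC x); linarith),
    choquet_eq_intervalIntegral hinc h0 hf (fun x => (abs_le.1 (hC x)).1)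
      (fun x => (abs_le.1 (hC x)).2),
    ← intervalIntegral.integral_comp_add_right (fun t => φ {x | t ≤ f x + c})]
  simp only [add_le_add_iff_right]
  ring

theorem choquet_const_mul [Nonempty J] (hinc : SetfunIncreasing φ) (h0 : φ ∅ = 0)
    {f : J → ℝ} (hf : Measurable f) {C : ℝ} (hC : ∀ x, |f x| ≤ C) {r : ℝ} (hr : 0 < r) :
    choquet φ (fun x => r * f x) = r * choquet φ f := by
  rw [choquet_eq_intervalIntegral hinc h0 (hf.const_mul r) (a := r * -C) (b := r * C)
      (fun x => mul_le_mul_of_nonneg_left (abs_le.1 (hC x)).1 hr.le)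
      (fun x => mul_le_mul_of_nonneg_left (abs_le.1 (hC x)).2 hr.le),
    choquet_eq_intervalIntegral hinc h0 hf (fun x => (abs_le.1 (hC x)).1)
      (fun x => (abs_le.1 (hC x)).2),
    ← intervalIntegral.mul_integral_comp_mul_left (f := fun t => φ {x | t ≤ r * f x})]
  simp only [mul_le_mul_iff_right₀ hr]
  ring

/-- Subadditivity when one summand is a multiple of an indicator. The level sets of
`f + h • 1_A` are `{t ≤ f} ∪ (A ∩ {t - h ≤ f})`; submodularity compares them with those of `f`, and
the error telescopes to the integral of `φ (A ∩ {t ≤ f})` over an interval of length `h`. -/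
theorem choquet_add_indicator_le [Nonempty J] (hinc : SetfunIncreasing φ)
    (hsub : SetfunSubmodular φ) (h0 : φ ∅ = 0) {f : J → ℝ} (hf : Measurable f) {C : ℝ}
    (hC : ∀ x, |f x| ≤ C) {A : Set J} (hA : MeasurableSet A) {h : ℝ} (hh : 0 ≤ h) :
    choquet φ (fun x => f x + h * A.indicator 1 x) ≤ choquet φ f + h * φ A := by
  have hfC := fun x => abs_le.1 (hC x)
  have hind : ∀ x, 0 ≤ A.indicator (1 : J → ℝ) x ∧ A.indicator (1 : J → ℝ) x ≤ 1 := fun x => by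
    by_cases hx : x ∈ A <;> simp [hx]
  have hm : Measurable (fun x => f x + h * A.indicator 1 x) :=
    hf.add ((measurable_one.indicator hA).const_mul h)
  have hml : ∀ t : ℝ, MeasurableSet {x | t ≤ f x} := fun t => measurableSet_le measurable_const hf
  have hC0 : 0 ≤ C := (abs_nonneg _).trans (hC (Classical.arbitrary J))
  set ψ : ℝ → ℝ := fun t => φ (A ∩ {x | t ≤ f x}) with hψ
  have hψa : Antitone ψ := hinc.antitone_level hf hA
  have hψi : ∀ a b : ℝ, IntervalIntegrable ψ volume a b := fun a b => hψa.intervalIntegrable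
  rw [choquet_eq_intervalIntegral hinc h0 hm (a := -C) (b := C + h)
      (fun x => by nlinarith [hfC x, hind x]) (fun x => by nlinarith [hfC x, hind x]),
    choquet_eq_intervalIntegral hinc h0 hf (a := -C) (b := C + h)
      (fun x => (hfC x).1) (fun x => by linarith [hfC x])]
  have key : ∀ t : ℝ, φ {x | t ≤ f x + h * A.indicator 1 x} ≤
      φ {x | t ≤ f x} + (ψ (t - h) - ψ t) := fun t => by
    have e1 : {x | t ≤ f x + h * A.indicator 1 x} = {x | t ≤ f x} ∪ (A ∩ {x | t - h ≤ f x}) := by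
      ext x
      by_cases hx : x ∈ A
      · simp only [mem_ofPred_eq, hx, indicator_of_mem, Pi.one_apply, mul_one, mem_union,
          mem_inter_iff, true_and, sub_le_iff_le_add]
        constructor
        · exact Or.inr
        · rintro (h | h) <;> linarith
      · simp [hx]
    have e2 : {x | t ≤ f x} ∩ (A ∩ {x | t - h ≤ f x}) = A ∩ {x | t ≤ f x} := by
      ext x
      simp only [mem_inter_iff, mem_ofPred_eq]
      constructor
      · tauto
      · rintro ⟨h1, h2⟩
        exact ⟨h2, h1, by linarith⟩
    have := hsub _ _ (hml t) (hA.inter (hml (t - h)))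
    rw [← e1, e2] at this
    simp only [hψ]
    linarith
  have hshift : (∫ t in (-C)..(C + h), ψ (t - h)) = ∫ t in (-C - h)..C, ψ t := by
    rw [intervalIntegral.integral_comp_sub_right]
    simp
  -- Below `-C` the level set is all of `A`.
  have hlow : (∫ t in (-C - h)..(-C), ψ t) = h * φ A := by
    rw [intervalIntegral.integral_congr (g := fun _ => φ A)]
    · simp
    · intro t ht
      rw [uIcc_of_le (by linarith)] at ht
      have : A ∩ {x | t ≤ f x} = A :=
        inter_eq_left.2 fun x _ => ht.2.trans (hfC x).1
      simp [hψ, this]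
  have hhigh : 0 ≤ ∫ t in C..(C + h), ψ t :=
    intervalIntegral.integral_nonneg (by linarith) fun t _ =>
      hinc.nonneg h0 (hA.inter (hml t))
  have hs1 := intervalIntegral.integral_add_adjacent_intervals (hψi (-C - h) (-C)) (hψi (-C) C)
  have hs2 := intervalIntegral.integral_add_adjacent_intervals (hψi (-C) C) (hψi C (C + h))
  have hψs : IntervalIntegrable (fun t => ψ (t - h)) volume (-C) (C + h) :=
    Antitone.intervalIntegrable fun s t hst => hψa (by linarith)
  have hmono := intervalIntegral.integral_mono_on (μ := volume) (by linarith : -C ≤ C + h)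
    (hinc.antitone_level_univ hm).intervalIntegrable
    ((hinc.antitone_level_univ hf).intervalIntegrable.add (hψs.sub (hψi _ _))) fun t _ => key t
  rw [intervalIntegral.integral_add (hinc.antitone_level_univ hf).intervalIntegrable
    (hψs.sub (hψi _ _)), intervalIntegral.integral_sub hψs (hψi _ _), hshift] at hmono
  linarith

theorem choquet_add_sum_indicator_le [Nonempty J] (hinc : SetfunIncreasing φ)
    (hsub : SetfunSubmodular φ) (h0 : φ ∅ = 0) {f : J → ℝ} (hf : Measurable f) {C : ℝ}
    (hC : ∀ x, |f x| ≤ C) {A : ℕ → Set J} (hA : ∀ i, MeasurableSet (A i)) {h : ℝ} (hh : 0 ≤ h)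
    (n : ℕ) :
    choquet φ (fun x => f x + h * ∑ i ∈ Finset.range n, (A i).indicator 1 x) ≤
      choquet φ f + h * ∑ i ∈ Finset.range n, φ (A i) := by
  induction n with
  | zero => simp
  | succ n ih =>
    have hm : Measurable fun x => f x + h * ∑ i ∈ Finset.range n, (A i).indicator (1 : J → ℝ) x :=
      hf.add ((Finset.measurable_fun_sum _ fun i _ => measurable_one.indicator (hA i)).const_mul h)
    have hb : ∀ x, |f x + h * ∑ i ∈ Finset.range n, (A i).indicator (1 : J → ℝ) x| ≤
        C + h * n := fun x => by
      have h1 : 0 ≤ ∑ i ∈ Finset.range n, (A i).indicator (1 : J → ℝ) x :=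
        Finset.sum_nonneg fun i _ => indicator_nonneg (fun _ _ => zero_le_one) x
      have h2 : ∑ i ∈ Finset.range n, (A i).indicator (1 : J → ℝ) x ≤ n := by
        simpa using Finset.sum_le_card_nsmul (Finset.range n)
          (fun i => (A i).indicator (1 : J → ℝ) x) 1
          fun i _ => by by_cases hx : x ∈ A i <;> simp [hx]
      refine (abs_add_le _ _).trans (add_le_add (hC x) ?_)
      rw [abs_of_nonneg (mul_nonneg hh h1)]
      gcongr
    have := choquet_add_indicator_le hinc hsub h0 hm hb (hA n) hh
    simp only [Finset.sum_range_succ, mul_add, ← add_assoc]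
    linarith

/-- Counting the integers in `[1, u]` recovers `u` up to an error of one. -/
theorem le_one_add_sum_level (u : ℝ) (n : ℕ) (hu : u ≤ n) :
    u ≤ 1 + ∑ i ∈ Finset.range n, if (i : ℝ) + 1 ≤ u then (1 : ℝ) else 0 := by
  induction n with
  | zero => simp at hu ⊢; linarith
  | succ n ih =>
    rcases le_or_gt u n with h | h
    · rw [Finset.sum_range_succ]
      have := ih h
      split_ifs <;> linarith
    · rw [Finset.sum_range_succ]
      have : ∑ i ∈ Finset.range n, (if (i : ℝ) + 1 ≤ u then (1 : ℝ) else 0) = n := by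
        rw [Finset.sum_congr rfl (g := fun _ => (1 : ℝ))]
        · simp
        · intro i hi
          have : ((i + 1 : ℕ) : ℝ) ≤ n := by exact_mod_cast Finset.mem_range.1 hi
          push_cast at this
          rw [if_pos (by linarith)]
      push_cast at hu
      rw [this]
      split_ifs <;> linarith

/-- Lower Riemann sum of an antitone function with step `h`. -/
theorem Antitone.mul_sum_le_intervalIntegral {ψ : ℝ → ℝ} (hψ : Antitone ψ) (a : ℝ) {h : ℝ}
    (hh : 0 < h) (n : ℕ) :
    h * ∑ i ∈ Finset.range n, ψ (a + h * (i + 1)) ≤ ∫ t in a..(a + h * n), ψ t := by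
  have hanti : Antitone fun s => ψ (a + h * s) := fun s t hst =>
    hψ (by gcongr)
  have := (hanti.antitoneOn (Icc (0 : ℝ) (0 + n))).sum_le_integral
  have e := intervalIntegral.mul_integral_comp_add_mul (a := 0) (b := n) (f := ψ) h a
  simp only [zero_add, mul_zero, add_zero, Nat.cast_add, Nat.cast_one] at this e
  rw [← e]
  gcongr

/-- Subadditivity of the Choquet integral: approximate `g` by an equally spaced sum of indicators
of its level sets and add these one at a time. -/
theorem choquet_add_le [Nonempty J] (hinc : SetfunIncreasing φ)
    (hsub : SetfunSubmodular φ) (h0 : φ ∅ = 0) {f g : J → ℝ} (hf : Measurable f)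
    (hg : Measurable g) {C D : ℝ} (hfC : ∀ x, |f x| ≤ C) (hgD : ∀ x, |g x| ≤ D) :
    choquet φ (fun x => f x + g x) ≤ choquet φ f + choquet φ g := by
  obtain ⟨K, hK, hgK⟩ : ∃ K : ℝ, 0 < K ∧ ∀ x, |g x| ≤ K :=
    ⟨|D| + 1, by positivity, fun x => by have := hgD x; have := le_abs_self D; linarith⟩
  have step : ∀ n : ℕ, choquet φ (fun x => f x + g x) ≤
      choquet φ f + choquet φ g + 2 * K * φ univ * (1 / ((n : ℝ) + 1)) := fun n => by
    set h : ℝ := 2 * K / ((n : ℝ) + 1) with hh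
    have hhpos : 0 < h := by positivity
    have hhn : h * ((n + 1 : ℕ) : ℝ) = 2 * K := by push_cast; rw [hh]; field_simp
    set A : ℕ → Set J := fun i => {x | -K + h * ((i : ℝ) + 1) ≤ g x} with hA
    have hAm : ∀ i, MeasurableSet (A i) := fun i => measurableSet_le measurable_const hg
    -- The step function `-K + h * ∑ 1_{A i}` lies below `g`, by less than `h`.
    have hle : ∀ x, f x + g x ≤ (f x + (-K + h)) +
        h * ∑ i ∈ Finset.range (n + 1), (A i).indicator (1 : J → ℝ) x := fun x => by
      have hu : (g x + K) / h ≤ (n + 1 : ℕ) := by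
        rw [div_le_iff₀ hhpos, mul_comm, hhn]
        have := (abs_le.1 (hgK x)).2
        linarith
      have := le_one_add_sum_level _ _ hu
      have e : ∀ i ∈ Finset.range (n + 1), (if (i : ℝ) + 1 ≤ (g x + K) / h then (1 : ℝ) else 0) =
          (A i).indicator 1 x := fun i _ => by
        have : (i : ℝ) + 1 ≤ (g x + K) / h ↔ x ∈ A i := by
          rw [le_div_iff₀ hhpos, mem_ofPred_eq]
          constructor <;> intro <;> linarith
        by_cases hx : x ∈ A i <;> simp [this, hx]
      rw [Finset.sum_congr rfl e, div_le_iff₀ hhpos] at this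
      linarith
    have hfm : Measurable fun x => f x + (-K + h) := hf.add_const _
    have hfb : ∀ x, |f x + (-K + h)| ≤ C + |-K + h| := fun x =>
      (abs_add_le _ _).trans (by gcongr; exact hfC x)
    have hsb : ∀ x, |(f x + (-K + h)) +
        h * ∑ i ∈ Finset.range (n + 1), (A i).indicator (1 : J → ℝ) x| ≤
          C + |-K + h| + h * (n + 1 : ℕ) := fun x => by
      refine (abs_add_le _ _).trans (add_le_add (hfb x) ?_)
      rw [abs_mul, abs_of_pos hhpos]
      gcongr
      refine (Finset.abs_sum_le_sum_abs _ _).trans ?_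
      simpa using Finset.sum_le_card_nsmul (Finset.range (n + 1))
        (fun i => |(A i).indicator (1 : J → ℝ) x|) 1
        fun i _ => by by_cases hx : x ∈ A i <;> simp [hx]
    have h1 := choquet_mono hinc h0 (hf.add hg) (hfm.add
      ((Finset.measurable_fun_sum _ fun i _ => measurable_one.indicator (hAm i)).const_mul h))
      (fun x => (abs_add_le _ _).trans (add_le_add (hfC x) (hgD x))) hsb hle
    have h2 := choquet_add_sum_indicator_le hinc hsub h0 hfm hfb hAm hhpos.le (n + 1)
    rw [choquet_add_const hinc h0 hf hfC] at h2
    have h3 := (hinc.antitone_level_univ hg).mul_sum_le_intervalIntegral (-K) hhpos (n + 1)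
    rw [hhn] at h3
    have h4 := choquet_eq_intervalIntegral hinc h0 hg (fun x => (abs_le.1 (hgK x)).1)
      (b := -K + 2 * K) (fun x => by linarith [(abs_le.1 (hgK x)).2])
    have h5 : 2 * K * φ univ * (1 / ((n : ℝ) + 1)) = h * φ univ := by rw [hh]; ring
    have h12 : choquet φ (fun x => f x + g x) ≤ _ := h1.trans h2
    rw [h5, h4]
    linarith
  have hlim : Filter.Tendsto (fun n : ℕ => choquet φ f + choquet φ g +
      2 * K * φ univ * (1 / ((n : ℝ) + 1))) Filter.atTop (nhds (choquet φ f + choquet φ g)) := by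
    simpa using (tendsto_one_div_add_atTop_nhds_zero_nat (𝕜 := ℝ)).const_mul
      (2 * K * φ univ) |>.const_add (choquet φ f + choquet φ g)
  exact ge_of_tendsto' hlim step

/-- Stability of the Choquet integral under a small perturbation off a small set. -/
theorem choquet_le_of_le_add_off [Nonempty J] (hinc : SetfunIncreasing φ)
    (hsub : SetfunSubmodular φ) (h0 : φ ∅ = 0) {f g : J → ℝ} (hf : Measurable f)
    (hg : Measurable g) {C ε : ℝ} (hfC : ∀ x, |f x| ≤ C) (hgC : ∀ x, |g x| ≤ C) (hε : 0 ≤ ε)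
    {A : Set J} (hA : MeasurableSet A) (hfg : ∀ x ∉ A, f x ≤ g x + ε) :
    choquet φ f ≤ choquet φ g + ε * φ univ + 2 * C * φ A := by
  have hC0 : 0 ≤ C := (abs_nonneg _).trans (hfC (Classical.arbitrary J))
  have hgb : ∀ x, |g x + ε| ≤ C + |ε| := fun x => (abs_add_le _ _).trans (by gcongr; exact hgC x)
  rw [← choquet_add_const hinc h0 hg hgC]
  refine le_trans ?_ (choquet_add_indicator_le hinc hsub h0 (hg.add_const ε) hgb hA
    (by linarith : 0 ≤ 2 * C))
  refine choquet_mono hinc h0 hf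
    ((hg.add_const ε).add ((measurable_one.indicator hA).const_mul _)) hfC
    (D := C + |ε| + 2 * C) (fun x => ?_) fun x => ?_
  · refine (abs_add_le _ _).trans (add_le_add (hgb x) ?_)
    rw [abs_mul, abs_of_nonneg (by linarith : 0 ≤ 2 * C)]
    by_cases hx : x ∈ A <;> simp [hx, hC0]
  · have := abs_le.1 (hfC x)
    have := abs_le.1 (hgC x)
    by_cases hx : x ∈ A
    · simp only [hx, indicator_of_mem, Pi.one_apply]; linarith
    · simpa [hx] using hfg x hx

theorem abs_choquet_le [Nonempty J] (hinc : SetfunIncreasing φ) (h0 : φ ∅ = 0)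
    {f : J → ℝ} (hf : Measurable f) {C : ℝ} (hC : ∀ x, |f x| ≤ C) :
    |choquet φ f| ≤ C * φ univ := by
  have hconst : ∀ c : ℝ, choquet φ (fun _ : J => c) = c * φ univ := fun c => by
    rw [choquet_eq_intervalIntegral hinc h0 measurable_const (fun _ => le_refl c)
      (fun _ => le_refl c)]
    simp
  have h1 := choquet_mono hinc h0 (measurable_const (a := -C)) hf (C := |C|)
    (fun _ => (abs_neg C).le) hC fun x => (abs_le.1 (hC x)).1
  have h2 := choquet_mono hinc h0 hf (measurable_const (a := C)) hC (D := |C|)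
    (fun _ => le_rfl) fun x => (abs_le.1 (hC x)).2
  rw [hconst] at h1 h2
  exact abs_le.2 ⟨by linarith, h2⟩

end Choquet

/-! ### Sections of product-measurable functions in `L¹` -/

section Sections

variable {I J : Type*} [MeasurableSpace I] [MeasurableSpace J] {π : Measure J}

theorem memLp_section [IsFiniteMeasure π] {F : J × I → ℝ} (hF : Measurable F) {C : ℝ}
    (hC : ∀ p, |F p| ≤ C) (y : I) : MemLp (fun x => F (x, y)) 1 π :=
  MemLp.of_bound (hF.comp measurable_prodMk_right).aestronglyMeasurable C
    (.of_forall fun x => hC (x, y))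

theorem tendsto_toLp_one_of_bounded [IsFiniteMeasure π] {f : ℕ → J → ℝ} {g : J → ℝ}
    (hf : ∀ n, MemLp (f n) 1 π) (hg : MemLp g 1 π) {C : ℝ} (hC : ∀ n x, |f n x| ≤ C)
    (hlim : ∀ x, Filter.Tendsto (fun n => f n x) Filter.atTop (nhds (g x))) :
    Filter.Tendsto (fun n => (hf n).toLp (f n)) Filter.atTop (nhds (hg.toLp g)) := by
  rw [Lp.tendsto_Lp_iff_tendsto_eLpNorm'']
  have := tendsto_lintegral_norm_of_dominated_convergence (μ := π) (bound := fun _ => C)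
    (fun n => (hf n).1) (hasFiniteIntegral_const C)
    (fun n => .of_forall fun x => hC n x) (.of_forall hlim)
  refine this.congr fun n => ?_
  simp only [eLpNorm_one_eq_lintegral_enorm, Pi.sub_apply, ofReal_norm]

/-- The sections of the indicator of a product-measurable set form a strongly measurable family
in `L¹`: such sets `E` include the rectangles and form a Dynkin system. -/
theorem stronglyMeasurable_toLp_section_indicator [IsFiniteMeasure π] {E : Set (J × I)}
    (hE : MeasurableSet E)
    (h : ∀ y, MemLp (fun x => E.indicator (1 : J × I → ℝ) (x, y)) 1 π) :
    StronglyMeasurable fun y => (h y).toLp _ := by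
  have hone : ∀ E : Set (J × I), ∀ p, |E.indicator (1 : J × I → ℝ) p| ≤ 1 := fun E p => by
    by_cases hp : p ∈ E <;> simp [hp]
  induction E, hE using MeasurableSpace.induction_on_inter generateFrom_prod.symm
      isPiSystem_prod with
  | empty =>
    convert stronglyMeasurable_const (b := (0 : Lp ℝ 1 π)) using 2 with y
    rw [← MemLp.toLp_zero (MemLp.zero (ε := ℝ)), MemLp.toLp_eq_toLp_iff]
    exact .of_forall fun x => by simp
  | basic E hE =>
    obtain ⟨S, hS, T, hT, rfl⟩ := hE
    have hSm : MemLp (S.indicator (1 : J → ℝ)) 1 π :=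
      MemLp.of_bound ((measurable_one.indicator hS).aestronglyMeasurable) 1
        (.of_forall fun x => by by_cases hx : x ∈ S <;> simp [hx])
    convert (stronglyMeasurable_const (b := hSm.toLp _)).indicator hT using 1
    ext1 y
    by_cases hy : y ∈ T
    · rw [indicator_of_mem hy, MemLp.toLp_eq_toLp_iff]
      refine .of_forall fun x => ?_
      by_cases hx : x ∈ S <;> simp [hx, hy]
    · rw [indicator_of_notMem hy, ← MemLp.toLp_zero (MemLp.zero (ε := ℝ)), MemLp.toLp_eq_toLp_iff]
      refine .of_forall fun x => ?_
      simp [hy]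
  | compl E hE ih =>
    have hm := memLp_section (π := π) (measurable_one.indicator hE) (hone E)
    have h1 : MemLp (fun _ : J => (1 : ℝ)) 1 π := memLp_const 1
    convert (stronglyMeasurable_const (b := h1.toLp _)).sub (ih hm) using 1
    ext1 y
    rw [Pi.sub_apply, ← MemLp.toLp_sub, MemLp.toLp_eq_toLp_iff]
    refine .of_forall fun x => ?_
    by_cases hx : (x, y) ∈ E <;> simp [hx]
  | iUnion E hdisj hE ih =>
    have hm := fun n => memLp_section (π := π) (measurable_one.indicator (hE n)) (hone (E n))
    have hs := fun n y => memLp_finsetSum (μ := π) (p := 1) (Finset.range n)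
      (f := fun i x => (E i).indicator (1 : J × I → ℝ) (x, y)) fun i _ => hm i y
    have hsum : ∀ n y x, ∑ i ∈ Finset.range n, (E i).indicator (1 : J × I → ℝ) (x, y) =
        (⋃ i ∈ Finset.range n, E i).indicator 1 (x, y) := fun n y x => by
      rw [Finset.indicator_biUnion_apply]
      exact fun i _ j _ hij => hdisj hij
    refine stronglyMeasurable_of_tendsto Filter.atTop (f := fun n y => (hs n y).toLp _)
      (fun n => ?_) (tendsto_pi_nhds.2 fun y => ?_)
    · convert Finset.stronglyMeasurable_fun_sum (Finset.range n) fun i _ => ih i (hm i) using 1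
      ext1 y
      induction n with
      | zero =>
        rw [Finset.sum_range_zero, ← MemLp.toLp_zero (MemLp.zero (ε := ℝ)),
          MemLp.toLp_eq_toLp_iff]
        exact .of_forall fun x => by simp
      | succ n ihn =>
        rw [Finset.sum_range_succ, ← ihn, ← MemLp.toLp_add, MemLp.toLp_eq_toLp_iff]
        exact .of_forall fun x => by simp [Finset.sum_range_succ]
    · refine tendsto_toLp_one_of_bounded _ _ (C := 1) (fun n x => ?_) fun x => ?_
      · rw [hsum]
        exact hone _ _
      · simp only [hsum]
        by_cases hx : ∃ i, (x, y) ∈ E i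
        · obtain ⟨i, hi⟩ := hx
          refine tendsto_const_nhds.congr' ?_
          filter_upwards [Filter.eventually_gt_atTop i] with n hn
          rw [indicator_of_mem (mem_iUnion.2 ⟨i, hi⟩), indicator_of_mem]
          exact mem_biUnion (Finset.mem_coe.2 (Finset.mem_range.2 hn)) hi
        · push Not at hx
          simp [hx]

/-- The sections of a bounded product-measurable function form a strongly measurable family in
`L¹`. As `L¹` need not be separable, this does not follow from measurability alone. -/
theorem stronglyMeasurable_toLp_section [IsFiniteMeasure π] {F : J × I → ℝ} (hF : Measurable F)
    {C : ℝ} (hC : ∀ p, |F p| ≤ C) (h : ∀ y, MemLp (fun x => F (x, y)) 1 π) :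
    StronglyMeasurable fun y => (h y).toLp _ := by
  have hsimple : ∀ G : SimpleFunc (J × I) ℝ, ∀ h : ∀ y, MemLp (fun x => G (x, y)) 1 π,
      StronglyMeasurable fun y => (h y).toLp _ := fun G => by
    induction G using SimpleFunc.induction with
    | const c hE =>
      rename_i E
      intro h
      have hm := memLp_section (π := π) (measurable_one.indicator hE) (C := 1) fun p => by
        by_cases hp : p ∈ E <;> simp [hp]
      convert (stronglyMeasurable_toLp_section_indicator hE hm).const_smul c using 1
      ext1 y
      rw [Pi.smul_apply, ← MemLp.toLp_const_smul, MemLp.toLp_eq_toLp_iff]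
      refine .of_forall fun x => ?_
      by_cases hx : (x, y) ∈ E <;> simp [hx]
    | @add f g _ ihf ihg =>
      intro h
      have hm : ∀ f : SimpleFunc (J × I) ℝ, ∀ y, MemLp (fun x => f (x, y)) 1 π := fun f => by
        obtain ⟨D, hD⟩ := f.exists_forall_norm_le
        exact memLp_section f.measurable hD
      exact (ihf (hm f)).add (ihg (hm g))
  have hs := hF.stronglyMeasurable
  have hb := fun n p => hs.norm_approxBounded_le (c := C) ((abs_nonneg _).trans (hC p)) n p
  refine stronglyMeasurable_of_tendsto Filter.atTop
    (f := fun n y => (memLp_section (π := π) (hs.approxBounded C n).measurable (hb n) y).toLp _)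
    (fun n => hsimple _ _) (tendsto_pi_nhds.2 fun y => ?_)
  exact tendsto_toLp_one_of_bounded _ _ (fun n x => hb n (x, y)) fun x =>
    hs.tendsto_approxBounded_of_norm_le (hC (x, y))

theorem integrable_toLp_section (lam : Measure I) [IsFiniteMeasure lam] [IsFiniteMeasure π]
    {F : J × I → ℝ} (hF : Measurable F)
    {C : ℝ} (hC : ∀ p, |F p| ≤ C) (h : ∀ y, MemLp (fun x => F (x, y)) 1 π) :
    Integrable (fun y => (h y).toLp _) lam :=
  .of_bound (stronglyMeasurable_toLp_section hF hC h).aestronglyMeasurable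
    (measureUnivNNReal π ^ (1 : ENNReal).toReal⁻¹ * |C|) (.of_forall fun y =>
      Lp.norm_le_of_ae_bound (abs_nonneg C) (by
        filter_upwards [(h y).coeFn_toLp] with x hx
        rw [hx]
        exact (hC (x, y)).trans (le_abs_self C)))

/-- The Bochner integral in `L¹` of the sections is the pointwise integral. -/
theorem coeFn_integral_toLp_section (lam : Measure I) [IsFiniteMeasure lam]
    [IsFiniteMeasure π] {F : J × I → ℝ} (hF : Measurable F)
    {C : ℝ} (hC : ∀ p, |F p| ≤ C) (h : ∀ y, MemLp (fun x => F (x, y)) 1 π) :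
    (∫ y, (h y).toLp _ ∂lam : Lp ℝ 1 π) =ᵐ[π] fun x => ∫ y, F (x, y) ∂lam := by
  have hFi : ∀ ν : Measure J, [IsFiniteMeasure ν] → Integrable F (ν.prod lam) := fun ν _ =>
    .of_bound hF.aestronglyMeasurable C (.of_forall hC)
  refine Integrable.ae_eq_of_forall_setIntegral_eq _ _ (L1.integrable_coeFn _)
    (hFi π).integral_prod_left fun S _ _ => ?_
  -- Integration over `S` is a continuous functional on `L¹`, so it passes through the Bochner
  -- integral and Fubini's theorem applies.
  have hL : ∀ u : Lp ℝ 1 π, ((L1.integralCLM : Lp ℝ 1 (π.restrict S) →L[ℝ] ℝ) ∘L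
      LpToLpRestrictCLM J ℝ ℝ π 1 S) u =
      ∫ x in S, u x ∂π := fun u => by
    rw [ContinuousLinearMap.comp_apply, ← L1.integral_eq, L1.integral_eq_integral]
    exact integral_congr_ae (LpToLpRestrictCLM_coeFn ℝ S u)
  rw [← hL, ← ContinuousLinearMap.integral_comp_comm _ (integrable_toLp_section lam hF hC h),
    integral_integral_swap (f := fun x y => F (x, y)) (hFi (π.restrict S))]
  refine integral_congr_ae (.of_forall fun y => ?_)
  simp only [hL]
  exact integral_congr_ae (ae_restrict_of_ae (h y).coeFn_toLp)

end Sections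

/-! ### The Choquet integral as a functional on `L¹` -/

section ChoquetL1

variable {J : Type*} [MeasurableSpace J] {φ : Set J → ℝ} {π : Measure J}

/-- An absolutely continuous setfunction vanishes on null sets, so its Choquet integral only
depends on the almost everywhere class. -/
theorem choquet_congr_ae [Nonempty J] (hinc : SetfunIncreasing φ) (hsub : SetfunSubmodular φ)
    (hac : SetfunAbsCont φ π) {f g : J → ℝ} (hf : Measurable f) (hg : Measurable g) {C : ℝ}
    (hfC : ∀ x, |f x| ≤ C) (hgC : ∀ x, |g x| ≤ C) (hfg : f =ᵐ[π] g) :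
    choquet φ f = choquet φ g := by
  have hA : MeasurableSet {x | f x ≠ g x} := (measurableSet_eq_fun hf hg).compl
  have hφA : φ {x | f x ≠ g x} = 0 := hac.of_measure_zero hA hfg
  have h1 := choquet_le_of_le_add_off hinc hsub hac.map_empty hf hg hfC hgC le_rfl hA
    fun x hx => by rw [not_not.1 hx, add_zero]
  have h2 := choquet_le_of_le_add_off hinc hsub hac.map_empty hg hf hgC hfC le_rfl hA
    fun x hx => by rw [not_not.1 hx, add_zero]
  rw [hφA] at h1 h2
  linarith

/-- Truncation of a real number to the interval `[-C, C]`. -/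
def truncAt (C r : ℝ) : ℝ := max (-C) (min C r)

theorem measurable_truncAt (C : ℝ) : Measurable (truncAt C) := by
  unfold truncAt; fun_prop

theorem abs_truncAt_le {C : ℝ} (hC : 0 ≤ C) (r : ℝ) : |truncAt C r| ≤ C :=
  abs_le.2 ⟨le_max_left _ _, max_le (by linarith) (min_le_left _ _)⟩

theorem truncAt_of_abs_le {C r : ℝ} (h : |r| ≤ C) : truncAt C r = r := by
  rw [truncAt, min_eq_right (abs_le.1 h).2, max_eq_right (abs_le.1 h).1]

theorem truncAt_sub_le (C r s : ℝ) : truncAt C r ≤ truncAt C s + |r - s| := by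
  have h := abs_max_sub_max_le_abs (min C r) (min C s) (-C)
  have h' := abs_min_sub_min_le_max C r C s
  rw [sub_self, abs_zero, max_eq_right (abs_nonneg _)] at h'
  rw [truncAt, truncAt, max_comm, max_comm (-C)]
  linarith [le_abs_self (max (min C r) (-C) - max (min C s) (-C))]

/-- The Choquet integral as a functional on all of `L¹`, by first truncating to `[-C, C]`. It
agrees with `choquet` on the classes of functions bounded by `C`. -/
noncomputable def choquetL1 (φ : Set J → ℝ) (C : ℝ) (u : Lp ℝ 1 π) : ℝ :=
  choquet φ fun x => truncAt C (u x)

theorem measurable_truncAt_coeFn (C : ℝ) (u : Lp ℝ 1 π) : Measurable fun x => truncAt C (u x) :=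
  (measurable_truncAt C).comp (Lp.stronglyMeasurable u).measurable

theorem choquetL1_eq [Nonempty J] (hinc : SetfunIncreasing φ) (hsub : SetfunSubmodular φ)
    (hac : SetfunAbsCont φ π) {f : J → ℝ} (hf : Measurable f) {C : ℝ} (hC : ∀ x, |f x| ≤ C)
    {u : Lp ℝ 1 π} (hu : u =ᵐ[π] f) : choquetL1 φ C u = choquet φ f := by
  have hC0 : 0 ≤ C := (abs_nonneg _).trans (hC (Classical.arbitrary J))
  refine choquet_congr_ae hinc hsub hac (measurable_truncAt_coeFn C u) hf
    (fun x => abs_truncAt_le hC0 _) hC ?_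
  filter_upwards [hu] with x hx
  rw [hx, truncAt_of_abs_le (hC x)]

/-- Absolute continuity of `φ` makes the truncated Choquet integral continuous for the `L¹` norm,
since functions close in `L¹` are uniformly close off a set of small measure. -/
theorem continuous_choquetL1 [Nonempty J] [IsFiniteMeasure π] (hinc : SetfunIncreasing φ)
    (hsub : SetfunSubmodular φ) (hac : SetfunAbsCont φ π) {C : ℝ} (hC : 0 ≤ C) :
    Continuous (choquetL1 φ C : Lp ℝ 1 π → ℝ) := by
  have h0 := hac.map_empty
  have hJ : 0 ≤ φ univ := hinc.nonneg h0 .univ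
  rw [Metric.continuous_iff]
  intro v ε hε
  set η : ℝ := ε / (2 * (φ univ + 1)) with hη
  have hηpos : 0 < η := by positivity
  have hη1 : η * φ univ < ε / 2 := by
    rw [hη, div_mul_eq_mul_div, div_lt_div_iff₀ (by positivity) (by positivity)]
    nlinarith
  obtain ⟨δ, hδ, H⟩ := hac (ε / (4 * (C + 1))) (by positivity)
  have hδ1 : 2 * C * (ε / (4 * (C + 1))) ≤ ε / 2 := by
    rw [mul_div_assoc', div_le_div_iff₀ (by positivity) (by positivity)]
    nlinarith
  refine ⟨η * δ, by positivity, fun u hu => ?_⟩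
  -- Markov's inequality: `u` and `v` differ by at least `η` only on a set of measure below `δ`.
  set A : Set J := {x | η ≤ |u x - v x|} with hA
  have hAm : MeasurableSet A := measurableSet_le measurable_const
    ((Lp.stronglyMeasurable u).measurable.sub (Lp.stronglyMeasurable v).measurable).abs
  have hint : Integrable (fun x => |u x - v x|) π :=
    ((L1.integrable_coeFn u).sub (L1.integrable_coeFn v)).abs
  have hdist : dist u v = ∫ x, |u x - v x| ∂π := by
    rw [dist_eq_norm, L1.norm_eq_integral_norm]
    refine integral_congr_ae ?_
    filter_upwards [Lp.coeFn_sub u v] with x hx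
    rw [hx, Pi.sub_apply, Real.norm_eq_abs]
  have hmarkov := mul_meas_ge_le_integral_of_nonneg
    (.of_forall fun x => abs_nonneg (u x - v x)) hint η
  rw [← hdist] at hmarkov
  have hπA : π A < ENNReal.ofReal δ := by
    rw [← ENNReal.toReal_lt_toReal (measure_ne_top _ _) ENNReal.ofReal_ne_top,
      ENNReal.toReal_ofReal hδ.le]
    exact lt_of_mul_lt_mul_left (hmarkov.trans_lt hu) hηpos.le
  have hφA := (le_abs_self _).trans_lt (H A hAm hπA)
  have hb := fun w : Lp ℝ 1 π => fun x => abs_truncAt_le hC (w x)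
  have hφA' : 2 * C * φ A ≤ ε / 2 := le_trans (by gcongr) hδ1
  have h1 := choquet_le_of_le_add_off hinc hsub h0 (measurable_truncAt_coeFn C u)
    (measurable_truncAt_coeFn C v) (hb u) (hb v) hηpos.le hAm fun x hx => by
      have := truncAt_sub_le C (u x) (v x)
      have : |u x - v x| < η := not_le.1 hx
      linarith
  have h2 := choquet_le_of_le_add_off hinc hsub h0 (measurable_truncAt_coeFn C v)
    (measurable_truncAt_coeFn C u) (hb v) (hb u) hηpos.le hAm fun x hx => by
      have := truncAt_sub_le C (v x) (u x)
      have : |u x - v x| < η := not_le.1 hx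
      rw [abs_sub_comm] at this
      linarith
  rw [Real.dist_eq, abs_lt]
  unfold choquetL1
  constructor <;> linarith

theorem isClosed_setOf_ae_abs_le [IsFiniteMeasure π] (C : ℝ) :
    IsClosed {u : Lp ℝ 1 π | ∀ᵐ x ∂π, |u x| ≤ C} := by
  have : {u : Lp ℝ 1 π | ∀ᵐ x ∂π, |u x| ≤ C} = Icc (Lp.const 1 π (-C)) (Lp.const 1 π C) := by
    ext u
    rw [mem_Icc, ← Lp.coeFn_le, ← Lp.coeFn_le]
    constructor
    · intro h
      constructor
      · filter_upwards [h, Lp.coeFn_const (p := 1) (μ := π) (-C)] with x hx hc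
        rw [hc]
        exact (abs_le.1 hx).1
      · filter_upwards [h, Lp.coeFn_const (p := 1) (μ := π) C] with x hx hc
        rw [hc]
        exact (abs_le.1 hx).2
    · rintro ⟨h1, h2⟩
      filter_upwards [h1, h2, Lp.coeFn_const (p := 1) (μ := π) (-C),
        Lp.coeFn_const (p := 1) (μ := π) C] with x h1 h2 hc1 hc2
      rw [hc1] at h1
      rw [hc2] at h2
      exact abs_le.2 ⟨h1, h2⟩
  rw [this]
  exact isClosed_Icc

/-- On the classes bounded by `C`, where the truncation is invisible, subadditivity and positive
homogeneity of the Choquet integral give convexity. -/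
theorem convexOn_choquetL1 [Nonempty J] (hinc : SetfunIncreasing φ)
    (hsub : SetfunSubmodular φ) (hac : SetfunAbsCont φ π) {C : ℝ} (hC : 0 ≤ C) :
    ConvexOn ℝ {u : Lp ℝ 1 π | ∀ᵐ x ∂π, |u x| ≤ C} (choquetL1 φ C) := by
  have h0 := hac.map_empty
  have hcomb : ∀ (u v : Lp ℝ 1 π) (a b : ℝ), (a • u + b • v : Lp ℝ 1 π) =ᵐ[π]
      fun x => a * u x + b * v x := fun u v a b => by
    filter_upwards [Lp.coeFn_add (a • u) (b • v), Lp.coeFn_smul a u, Lp.coeFn_smul b v]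
      with x h1 h2 h3
    rw [h1, Pi.add_apply, h2, h3]
    rfl
  have habs : ∀ {a b r s : ℝ}, 0 ≤ a → 0 ≤ b → a + b = 1 → |r| ≤ C → |s| ≤ C →
      |a * r + b * s| ≤ C := fun {a b r s} ha hb hab hr hs => by
    refine (abs_add_le _ _).trans ?_
    rw [abs_mul, abs_mul, abs_of_nonneg ha, abs_of_nonneg hb]
    calc a * |r| + b * |s| ≤ a * C + b * C := by gcongr
      _ = C := by rw [← add_mul, hab, one_mul]
  refine convexOn_iff_forall_pos.2 ⟨fun u hu v hv a b ha hb hab => ?_,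
    fun u hu v hv a b ha hb hab => ?_⟩
  · filter_upwards [hu, hv, hcomb u v a b] with x hx hy h
    rw [h]
    exact habs ha hb hab hx hy
  · have hmu := measurable_truncAt_coeFn C u
    have hmv := measurable_truncAt_coeFn C v
    have hbd := fun w : Lp ℝ 1 π => fun x => abs_truncAt_le hC (w x)
    have hmul : ∀ (w : Lp ℝ 1 π) {c : ℝ}, 0 < c → ∀ x, |c * truncAt C (w x)| ≤ c * C :=
      fun w c hc x => by
        rw [abs_mul, abs_of_pos hc]
        exact mul_le_mul_of_nonneg_left (hbd w x) hc.le
    rw [choquetL1_eq hinc hsub hac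
      (f := fun x => a * truncAt C (u x) + b * truncAt C (v x))
      ((hmu.const_mul a).add (hmv.const_mul b))
      (fun x => habs ha.le hb.le hab (hbd u x) (hbd v x))
      (by
        filter_upwards [hu, hv, hcomb u v a b] with x hx hy h
        rw [h, truncAt_of_abs_le hx, truncAt_of_abs_le hy])]
    refine (choquet_add_le hinc hsub h0 (hmu.const_mul a) (hmv.const_mul b) (hmul u ha)
      (hmul v hb)).trans_eq ?_
    rw [choquet_const_mul hinc h0 hmu (hbd u) ha, choquet_const_mul hinc h0 hmv (hbd v) hb]
    rfl

end ChoquetL1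

/-! ### Jensen's inequality for the Choquet integral -/

theorem mainTheorem5 {I J : Type*} [MeasurableSpace I] [MeasurableSpace J]
    (lam : Measure I) [IsProbabilityMeasure lam]
    (π : Measure J) [IsProbabilityMeasure π]
    (φ : Set J → ℝ) (hinc : SetfunIncreasing φ) (hsub : SetfunSubmodular φ)
    (hac : SetfunAbsCont φ π)
    (F : J × I → ℝ) (hF : Measurable F) (hbd : ∃ C : ℝ, ∀ p, |F p| ≤ C) :
    Integrable (fun y => choquet φ (fun x => F (x, y))) lam ∧
      choquet φ (fun x => ∫ y, F (x, y) ∂lam) ≤ ∫ y, choquet φ (fun x => F (x, y)) ∂lam := by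
  obtain ⟨C, hC⟩ := hbd
  have : Nonempty J := π.nonempty_of_neZero
  have : Nonempty I := lam.nonempty_of_neZero
  have hC0 : 0 ≤ C := (abs_nonneg _).trans (hC (Classical.arbitrary (J × I)))
  have hFy : ∀ y, Measurable fun x => F (x, y) := fun y => hF.comp measurable_prodMk_right
  have hmem := memLp_section (π := π) hF hC
  have hG := stronglyMeasurable_toLp_section hF hC hmem
  have hcont := continuous_choquetL1 (π := π) hinc hsub hac hC0
  have hval : ∀ y, choquetL1 φ C ((hmem y).toLp _) = choquet φ fun x => F (x, y) := fun y =>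
    choquetL1_eq hinc hsub hac (hFy y) (fun x => hC (x, y)) (hmem y).coeFn_toLp
  have hint : Integrable (fun y => choquet φ fun x => F (x, y)) lam := by
    refine .of_bound ?_ (C * φ univ) (.of_forall fun y =>
      abs_choquet_le hinc hac.map_empty (hFy y) fun x => hC (x, y))
    simpa only [hval] using (hcont.comp_stronglyMeasurable hG).aestronglyMeasurable
  refine ⟨hint, ?_⟩
  have hjensen := (convexOn_choquetL1 hinc hsub hac hC0).map_integral_le hcont.continuousOn
    (isClosed_setOf_ae_abs_le C) (f := fun y => (hmem y).toLp _) (μ := lam)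
    (.of_forall fun y => by
      filter_upwards [(hmem y).coeFn_toLp] with x hx
      rw [hx]
      exact hC (x, y))
    (integrable_toLp_section lam hF hC hmem)
    (by simpa only [Function.comp_def, hval] using hint)
  have hgm : Measurable fun x => ∫ y, F (x, y) ∂lam :=
    (hF.stronglyMeasurable.integral_prod_right (f := fun x y => F (x, y))).measurable
  have hgC : ∀ x, |∫ y, F (x, y) ∂lam| ≤ C := fun x => by
    simpa using norm_integral_le_of_norm_le_const (μ := lam) (C := C)
      (f := fun y => F (x, y)) (.of_forall fun y => hC (x, y))
  rw [choquetL1_eq hinc hsub hac hgm hgC (coeFn_integral_toLp_section lam hF hC hmem)] at hjensen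
  simpa only [hval] using hjensen
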